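/- Let $V'\in\mathbb C(x)$ be a rational function, and let $\gamma\subset\mathbb C$ be an open $C^1$ Jordan arc with injective parametrization $\gamma:\mathbb R\to\mathbb C$ that avoids the poles of $V'$; its ends may lie at $\infty$ or at poles of $V'$. Let $V$ be a primitive of $V'$ along $\gamma$. Suppose that $\gamma$ is admissible: for every polynomial $f$ the integrals $\int_\gamma f\,e^{-V}dx$ and $\int_\gamma f\,V'e^{-V}dx$ converge absolutely, and $e^{-V}\to0$ at both ends of $\gamma$. For $N\ge0$ put $$Z^{(N)}=\frac1{N!}\int_{\gamma^N}\prod_{i<j}(\lambda_i-\lambda_j)^2\prod_{i}e^{-V(\lambda_i)}d\lambda_i ,\qquad d\mu^{(N)}(\Lambda)=\frac{1}{N!\,Z^{(N)}}\prod_{i<j}(\lambda_i-\lambda_j)^2\prod_{i}e^{-V(\lambda_i)}d\lambda_i ,$$ with $\Lambda=\operatorname{diag}(\lambda_1,\dots,\lambda_N)$, and suppose that $Z^{(N)}\neq0$ for all $N$. For pairwise distinct $x_1,\dots,x_n\in\mathbb C\setminus\overline{\gamma}$ let $$W_n^{(N)}(x_1,\dots,x_n)=\frac{\delta_{n,2}}{(x_1-x_2)^2}+\kappa_n^{(N)}(x_1,\dots,x_n),$$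 where $\kappa^{(N)}_n$ is the joint cumulant of the resolvents $\operatorname{Tr}\frac1{x_1-\Lambda},\dots,\operatorname{Tr}\frac1{x_n-\Lambda}$ under $\mu^{(N)}$; that is, the $\kappa^{(N)}$ are determined by $\int_{\gamma^N}d\mu^{(N)}(\Lambda)\prod_{i\in S}\operatorname{Tr}\frac1{x_i-\Lambda}=\sum_{\pi}\prod_{B\in\pi}\kappa^{(N)}_{|B|}(x_B)$ for all non-empty $S\subseteq\{1,\dots,n\}$, the sum running over all set partitions $\pi$ of $S$, with $x_B=(x_i)_{i\in B}$. Let $n\ge2$ and $N\ge1$. Then $W_n^{(N)}$ is holomorphic in $x_1$, and the following hold. 1. (Order $4$, coefficients polynomial in $x_1$.) For all fixed $x_2,\dots,x_n$ there are polynomials $C_0,\dots,C_4\in\mathbb C[x_1]$, not all zero, and polynomials $\hat C_0,\dots,\hat C_4\in\mathbb C[x_1]$, not all zero (both families may depend on $n$, $N$ and $x_2,\dots,x_n$), such that $$\sum_{k=0}^{4}C_k(x_1)\,W_n^{(N+k)}(x_1,\dots,x_n)=0,\qquad \sum_{k=0}^{4}\hat C_k(x_1)\,\frac{\partial^k}{\partial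 x_1^k}W_n^{(N)}(x_1,\dots,x_n)=0$$ for all $x_1$ such that $x_1,\dots,x_n$ are pairwise distinct points of $\mathbb C\setminus\overline\gamma$. 2. (Order $4^n$, coefficients polynomial in all variables.) There are polynomials $\tilde C_0,\dots,\tilde C_{4^n}\in\mathbb C[x_1,\dots,x_n]$, not all zero, and polynomials $\check C_0,\dots,\check C_{4^n}\in\mathbb C[x_1,\dots,x_n]$, not all zero (both families may depend on $n$ and $N$), such that $$\sum_{k=0}^{4^n}\tilde C_k(x_1,\dots,x_n)\,W_n^{(N+k)}(x_1,\dots,x_n)=0,\qquad \sum_{k=0}^{4^n}\check C_k(x_1,\dots,x_n)\,\frac{\partial^k}{\partial x_1^k}W_n^{(N)}(x_1,\dots,x_n)=0$$ for all pairwise distinct $x_1,\dots,x_n\in\mathbb C\setminus\overline\gamma$. In particular, for $n=2$ the recursion has order $16$. The same assertions hold if $W_n^{(N)}$ is instead defined as the joint cumulant formed from the shifted moments $\hat W_k^{(N)}(x_1,\dots,x_k)=\frac{\delta_{k,2}}{(x_1-x_2)^2}+\int_{\gamma^N} d\mu^{(N)}(\Lambda)\prod_{i=1}^k\operatorname{Tr}\frac1{x_i-\Lambda}$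 (the two definitions agree for $n=2$). -/

import Mathlib

open Polynomial Filter Topology MeasureTheory

/-- An admissible open arc for a potential with rational derivative `dV`.
The `C¹` injective map `γ : ℝ → ℂ` parametrizes the arc (its two ends `t → ±∞` may lie at infinity
or at poles of `dV`), and `v t` is the value at `γ t` of a branch of the potential, that is, a
primitive of `dV` along the arc. -/
structure IsAdmissibleArc (dV : RatFunc ℂ) (γ v : ℝ → ℂ) : Prop where
  contDiff : ContDiff ℝ 1 γ
  injective : Function.Injective γ
  denom_ne_zero : ∀ t, dV.denom.eval (γ t) ≠ 0
  hasDerivAt : ∀ t, HasDerivAt v (dV.eval (RingHom.id ℂ) (γ t) * deriv γ t) t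
  /-- `∫_γ f(x) e^{-V(x)} dx` converges absolutely for all polynomials `f`. -/
  integrable : ∀ f : ℂ[X],
    Integrable fun t => f.eval (γ t) * (Complex.exp (-v t) * deriv γ t)
  /-- `∫_γ f(x) V'(x) e^{-V(x)} dx` converges absolutely for all polynomials `f`. -/
  integrable_deriv : ∀ f : ℂ[X],
    Integrable fun t => f.eval (γ t) * dV.eval (RingHom.id ℂ) (γ t) *
      (Complex.exp (-v t) * deriv γ t)
  /-- The weight `e^{-V}` vanishes at both ends of the arc. -/
  vanish_atTop : Tendsto (fun t => Complex.exp (-v t)) atTop (𝓝 0)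
  vanish_atBot : Tendsto (fun t => Complex.exp (-v t)) atBot (𝓝 0)

/-- The Vandermonde product `∏_{i<j} (λ_i - λ_j)`. -/
noncomputable def vandermondeProd {N : ℕ} (l : Fin N → ℂ) : ℂ :=
  ∏ i, ∏ j ∈ Finset.Ioi i, (l i - l j)

/-- `∫_{γ^N} F(Λ) Δ(Λ)² e^{-Tr V(Λ)} dλ_1 ⋯ dλ_N`, written in the parameter of the arc. -/
noncomputable def eigenIntegral (γ v : ℝ → ℂ) (N : ℕ) (F : (Fin N → ℂ) → ℂ) : ℂ :=
  ∫ t : Fin N → ℝ, F (fun i => γ (t i)) * vandermondeProd (fun i => γ (t i)) ^ 2 *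
    ∏ i, (Complex.exp (-v (t i)) * deriv γ (t i))

/-- The partition function `Z^{(N)}`. -/
noncomputable def partitionFunction (γ v : ℝ → ℂ) (N : ℕ) : ℂ :=
  1 / (N.factorial : ℂ) * eigenIntegral γ v N (fun _ => 1)

/-- The expectation `∫_{γ^N} F(Λ) dμ(Λ)`. -/
noncomputable def expectation (γ v : ℝ → ℂ) (N : ℕ) (F : (Fin N → ℂ) → ℂ) : ℂ :=
  1 / ((N.factorial : ℂ) * partitionFunction γ v N) * eigenIntegral γ v N F

/-- The joint moment `∫ dμ(Λ) ∏_{i ∈ S} Tr 1/(x_i - Λ)` of the resolvents indexed by `S`. -/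
noncomputable def resolventMoment (γ v : ℝ → ℂ) (N : ℕ) {n : ℕ} (x : Fin n → ℂ)
    (S : Finset (Fin n)) : ℂ :=
  expectation γ v N fun l => ∏ i ∈ S, ∑ j, 1 / (x i - l j)

/-- The double pole `1/(x_i - x_j)²` when `S = {i, j}` has exactly two elements, else `0`. -/
noncomputable def doublePole {n : ℕ} (x : Fin n → ℂ) (S : Finset (Fin n)) : ℂ :=
  if S.card = 2 then ∑ i ∈ S, ∑ j ∈ S with i < j, 1 / (x i - x j) ^ 2 else 0

/-- The cumulants `c` of a family `m` indexed by finite sets, obtained by inverting the triangular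
system `m(S) = ∑_{π partition of S} ∏_{B ∈ π} c(B)`; the partitions other than `{S}` are those of
which `S` is not a part. -/
noncomputable def cumulant {ι : Type*} [DecidableEq ι] (m : Finset ι → ℂ) (S : Finset ι) : ℂ :=
  m S - ∑ π : {π : Finpartition S // S ∉ π.parts}, ∏ B : {B // B ∈ π.1.parts}, cumulant m B.1
termination_by S.card
decreasing_by
  exact Finset.card_lt_card
    (lt_of_le_of_ne (π.1.le B.2) fun h => π.2 (by simpa [h] using B.2))

/-- The defining relation of the cumulants. -/
theorem sum_prod_cumulant {ι : Type*} [DecidableEq ι] (m : Finset ι → ℂ) (S : Finset ι)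
    (hS : S.Nonempty) :
    m S = ∑ π : Finpartition S, ∏ B ∈ π.parts, cumulant m B := by
  have hS' : S ≠ ⊥ := hS.ne_empty
  have h1 : ∀ π : Finpartition S, S ∈ π.parts ↔ π = Finpartition.indiscrete hS' := by
    intro π
    constructor
    · intro h
      ext B
      simp only [Finpartition.indiscrete_parts, Finset.mem_singleton]
      constructor
      · intro hB
        by_contra hne
        have hd := π.disjoint hB h hne
        exact π.ne_bot hB (hd.eq_bot_of_le (π.le hB))
      · rintro rfl
        exact h
    · rintro rfl
      simp
  rw [← Finset.sum_filter_add_sum_filter_not Finset.univ (fun π : Finpartition S => S ∈ π.parts)]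
  have h2 : (Finset.univ.filter fun π : Finpartition S => S ∈ π.parts)
      = {Finpartition.indiscrete hS'} := by
    ext π
    simp [h1]
  have h3 : ∑ π : Finpartition S with S ∉ π.parts, ∏ B ∈ π.parts, cumulant m B
      = ∑ π : {π : Finpartition S // S ∉ π.parts},
          ∏ B : {B // B ∈ π.1.parts}, cumulant m B.1 := by
    rw [← Finset.sum_subtype_eq_sum_filter, Finset.subtype_univ]
    refine Finset.sum_congr rfl fun π _ => ?_
    exact (Finset.prod_coe_sort π.1.parts (fun B => cumulant m B)).symm
  rw [h2, h3, Finset.sum_singleton, Finpartition.indiscrete_parts, Finset.prod_singleton]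
  conv_rhs => rw [cumulant]
  ring

/-- The correlator `W_n^{(N)}(x_1,…,x_n)`: the joint cumulant of the resolvents
`Tr 1/(x_i - Λ)`, plus `1/(x_1 - x_2)²` if `n = 2`. -/
noncomputable def correlator (γ v : ℝ → ℂ) (n N : ℕ) (x : Fin n → ℂ) : ℂ :=
  cumulant (resolventMoment γ v N x) Finset.univ + doublePole x Finset.univ

/-- The variant of the correlator in which the double pole is added to the second moments before
the cumulants are formed: the cumulant of
`Ŵ_k = δ_{k,2}/(x_1 - x_2)² + ∫ dμ(Λ) ∏_{i ≤ k} Tr 1/(x_i - Λ)`. -/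
noncomputable def shiftedCorrelator (γ v : ℝ → ℂ) (n N : ℕ) (x : Fin n → ℂ) : ℂ :=
  cumulant (fun S => doublePole x S + resolventMoment γ v N x S) Finset.univ

/-- Pairwise distinct points lying off the closed arc. -/
def configurations (γ : ℝ → ℂ) (n : ℕ) : Set (Fin n → ℂ) :=
  {x | Function.Injective x ∧ ∀ i, x i ∉ closure (Set.range γ)}

/-!
The theorem holds because every correlator is multi-affine in one fixed function, the Stieltjes
transform `ω(z) = ∫_γ e^{-V(x)} / (z - x) dx` of the one-particle weight. For every `N`, the function
`W_n^{(N)}(x_1, …, x_n)` is a combination of the `2^n` products `∏_{i ∈ T} ω(x_i)`, with coefficients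
rational in `x_1, …, x_n` whose only poles are on the diagonals `x_i = x_j` (`IsMultiaffine`).

For the moments this follows from expanding the squared Vandermonde determinant into monomials and
the product of traces into single terms, so that the `N`-fold integral splits into one-dimensional
ones (`IsAdmissibleArc.isMultiaffine_eigenIntegral`). Partial fractions reduce each of these to
integrals with a single Cauchy kernel, that is, to a polynomial multiple of `ω(x_i)` plus a
polynomial (`exists_cauchyIntegral_eval_mul`, `IsAdmissibleArc.isMultiaffine_integral`). Different
one-dimensional integrals involve different variables, hence the product is of degree at most one in
each `ω(x_i)`. The blocks of a partition are disjoint too, so cumulants inherit this form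
(`IsMultiaffine.cumulant`), and adding double poles, before or after, does not affect it.

Hence the functions `W_n^{(N+k)}` live in a space of dimension `2^n ≤ 4^n` over the rational
functions of all variables, and for fixed `x_2, …, x_n` in a space of dimension `2` over the rational
functions of `x_1`; more functions than the dimension are linearly dependent
(`exists_linear_relation`). For the differential equations, integration by parts gives
`q ω' = -p ω + r` with `V' = p / q` and a polynomial `r`
(`IsAdmissibleArc.exists_hasDerivAt_cauchyIntegral`), so the same spaces are stable under `∂/∂x_1`
(`InRationalSpan.deriv`). Clearing denominators makes the coefficients polynomials. The zeros of `q`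
off the arc do no harm, since `q` enters only through the denominators that are cleared.
-/

/-! ### Cauchy integrals along an arc -/

/-- The Cauchy integral `∫ u(t) / (z - γ(t)) dt` of a density `u` on a parametrized curve `γ`. -/
noncomputable def cauchyIntegral (γ : ℝ → ℂ) (u : ℝ → ℂ) (z : ℂ) : ℂ :=
  ∫ t, 1 / (z - γ t) * u t

theorem exists_pos_le_norm_sub {γ : ℝ → ℂ} {z : ℂ} (hz : z ∉ closure (Set.range γ)) :
    ∃ δ > 0, ∀ s ∈ Metric.ball z δ, ∀ t, δ ≤ ‖s - γ t‖ := by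
  obtain ⟨ε, hε, h⟩ := Metric.isOpen_iff.1 isClosed_closure.isOpen_compl z hz
  refine ⟨ε / 2, by positivity, fun s hs t => ?_⟩
  by_contra! hlt
  refine h (?_ : γ t ∈ Metric.ball z ε) (subset_closure ⟨t, rfl⟩)
  rw [Metric.mem_ball, dist_eq_norm] at hs ⊢
  calc ‖γ t - z‖ = ‖(s - z) - (s - γ t)‖ := by congr 1; ring
    _ ≤ ‖s - z‖ + ‖s - γ t‖ := norm_sub_le _ _
    _ < ε := by linarith

theorem sub_ne_zero_of_notMem_closure {γ : ℝ → ℂ} {z : ℂ} (hz : z ∉ closure (Set.range γ))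
    (t : ℝ) : z - γ t ≠ 0 := fun h =>
  hz (subset_closure ⟨t, (sub_eq_zero.1 h).symm⟩)

section

variable {γ u : ℝ → ℂ}

theorem integrable_cauchyKernel_mul (hγ : Continuous γ) (hu : Integrable u) {z : ℂ}
    (hz : z ∉ closure (Set.range γ)) : Integrable fun t => 1 / (z - γ t) * u t := by
  obtain ⟨δ, hδ, h⟩ := exists_pos_le_norm_sub hz
  refine hu.bdd_mul (c := 1 / δ) ?_ (.of_forall fun t => ?_)
  · exact (Continuous.div₀ (by fun_prop) (by fun_prop)
      (sub_ne_zero_of_notMem_closure hz)).aestronglyMeasurable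
  · rw [norm_div, norm_one]
    exact one_div_le_one_div_of_le hδ (h z (Metric.mem_ball_self hδ) t)

theorem hasDerivAt_cauchyIntegral (hγ : Continuous γ) (hu : Integrable u) {z : ℂ}
    (hz : z ∉ closure (Set.range γ)) :
    Integrable (fun t => -(1 / (z - γ t) ^ 2) * u t) ∧
    HasDerivAt (cauchyIntegral γ u) (∫ t, -(1 / (z - γ t) ^ 2) * u t) z := by
  obtain ⟨δ, hδ, h⟩ := exists_pos_le_norm_sub hz
  have hne : ∀ s ∈ Metric.ball z δ, ∀ t, s - γ t ≠ 0 := fun s hs t =>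
    norm_pos_iff.1 (hδ.trans_le (h s hs t))
  have hz' := Metric.mem_ball_self (x := z) hδ
  refine hasDerivAt_integral_of_dominated_loc_of_deriv_le (F := fun z t => 1 / (z - γ t) * u t)
    (F' := fun z t => -(1 / (z - γ t) ^ 2) * u t) (bound := fun t => 1 / δ ^ 2 * ‖u t‖)
    (Metric.ball_mem_nhds z hδ) ?_ (integrable_cauchyKernel_mul hγ hu hz) ?_ ?_ ?_ ?_
  · filter_upwards [Metric.ball_mem_nhds z hδ] with s hs
    exact (Continuous.div₀ (by fun_prop) (by fun_prop) (hne s hs)).aestronglyMeasurable.mul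
      hu.aestronglyMeasurable
  · exact (Continuous.div₀ (by fun_prop) (by fun_prop)
      fun t => pow_ne_zero 2 (hne z hz' t)).neg.aestronglyMeasurable.mul hu.aestronglyMeasurable
  · refine .of_forall fun t s hs => ?_
    rw [norm_mul, norm_neg, norm_div, norm_one, norm_pow]
    gcongr
    exact h s hs t
  · exact hu.norm.const_mul _
  · refine .of_forall fun t s hs => ?_
    have h1 := (((hasDerivAt_id s).sub_const (γ t)).inv (hne s hs t)).mul_const (u t)
    simpa [neg_div] using h1

/-- A polynomial factor `p(γ(t))` in the density may be moved out of a Cauchy integral, up to a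
polynomial: `(p(z) - p(w)) / (z - w)` is a polynomial in `z` and `w`. -/
theorem exists_cauchyIntegral_eval_mul (hγ : Continuous γ)
    (hu : ∀ f : ℂ[X], Integrable fun t => f.eval (γ t) * u t) (p : ℂ[X]) :
    ∃ r : ℂ[X], ∀ z ∉ closure (Set.range γ),
      cauchyIntegral γ (fun t => p.eval (γ t) * u t) z
        = p.eval z * cauchyIntegral γ u z + r.eval z := by
  induction p using Polynomial.induction_on with
  | C a =>
    refine ⟨0, fun z hz => ?_⟩
    simp only [cauchyIntegral, eval_C, eval_zero, add_zero, ← integral_const_mul]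
    congr 1 with t
    ring
  | add p q hp hq =>
    obtain ⟨r, hr⟩ := hp
    obtain ⟨s, hs⟩ := hq
    refine ⟨r + s, fun z hz => ?_⟩
    have : cauchyIntegral γ (fun t => (p + q).eval (γ t) * u t) z
        = cauchyIntegral γ (fun t => p.eval (γ t) * u t) z
          + cauchyIntegral γ (fun t => q.eval (γ t) * u t) z := by
      simp only [cauchyIntegral]
      rw [← integral_add (integrable_cauchyKernel_mul hγ (hu p) hz)
        (integrable_cauchyKernel_mul hγ (hu q) hz)]
      congr 1 with t
      rw [eval_add]
      ring
    rw [this, hr z hz, hs z hz, eval_add, eval_add]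
    ring
  | monomial n a h =>
    obtain ⟨r, hr⟩ := h
    refine ⟨X * r - C (∫ t, (C a * X ^ n).eval (γ t) * u t), fun z hz => ?_⟩
    have : cauchyIntegral γ (fun t => (C a * X ^ (n + 1)).eval (γ t) * u t) z
        = z * cauchyIntegral γ (fun t => (C a * X ^ n).eval (γ t) * u t) z
          - ∫ t, (C a * X ^ n).eval (γ t) * u t := by
      simp only [cauchyIntegral]
      rw [← integral_const_mul, ← integral_sub
        ((integrable_cauchyKernel_mul hγ (hu _) hz).const_mul z) (hu _)]
      congr 1 with t
      have := sub_ne_zero_of_notMem_closure hz t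
      simp only [eval_mul, eval_C, eval_pow, eval_X]
      field_simp
      ring
    rw [this, hr z hz]
    simp only [eval_mul, eval_C, eval_pow, eval_X, eval_sub]
    ring

end

/-- The density `e^{-V(γ(t))} γ'(t)` of the measure `e^{-V(x)} dx` on the arc. -/
noncomputable def arcWeight (γ v : ℝ → ℂ) (t : ℝ) : ℂ := Complex.exp (-v t) * deriv γ t

namespace IsAdmissibleArc

variable {dV : RatFunc ℂ} {γ v : ℝ → ℂ}

theorem continuous (hγ : IsAdmissibleArc dV γ v) : Continuous γ := hγ.contDiff.continuous

theorem integrable_arcWeight (hγ : IsAdmissibleArc dV γ v) : Integrable (arcWeight γ v) := by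
  have h : Integrable fun t => (1 : ℂ[X]).eval (γ t) * arcWeight γ v t := hγ.integrable 1
  simpa using h

/-- The Stieltjes transform `ω(z) = ∫_γ e^{-V(x)} / (z - x) dx` satisfies the inhomogeneous
first-order equation `q ω' = -p ω + r`, where `V' = p / q` and `r` is a polynomial. Integration by
parts turns `ω'` into `-∫_γ V'(x) e^{-V(x)} / (z - x) dx`, without boundary terms. -/
theorem exists_hasDerivAt_cauchyIntegral (hγ : IsAdmissibleArc dV γ v) :
    ∃ (r : ℂ[X]) (ω' : ℂ → ℂ), ∀ z ∉ closure (Set.range γ),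
      HasDerivAt (cauchyIntegral γ (arcWeight γ v)) (ω' z) z ∧
      dV.denom.eval z * ω' z
        = -(dV.num.eval z * cauchyIntegral γ (arcWeight γ v) z) + r.eval z := by
  set w := arcWeight γ v
  set u : ℝ → ℂ := fun t => dV.eval (RingHom.id ℂ) (γ t) * w t with hu_def
  have hw : ∀ f : ℂ[X], Integrable fun t => f.eval (γ t) * w t := hγ.integrable
  have hu : ∀ f : ℂ[X], Integrable fun t => f.eval (γ t) * u t := fun f => by
    simpa [hu_def, w, arcWeight, mul_assoc] using hγ.integrable_deriv f
  obtain ⟨r₁, hr₁⟩ := exists_cauchyIntegral_eval_mul hγ.continuous hu dV.denom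
  obtain ⟨r₂, hr₂⟩ := exists_cauchyIntegral_eval_mul hγ.continuous hw dV.num
  refine ⟨r₁ - r₂, fun z => ∫ t, -(1 / (z - γ t) ^ 2) * w t, fun z hz => ?_⟩
  obtain ⟨hint, hder⟩ := hasDerivAt_cauchyIntegral hγ.continuous hγ.integrable_arcWeight hz
  refine ⟨hder, ?_⟩
  have hne := sub_ne_zero_of_notMem_closure hz
  have hu1 : Integrable u := by simpa using hu 1
  have hint' : Integrable fun t => -(1 / (z - γ t) * u t) :=
    (integrable_cauchyKernel_mul hγ.continuous hu1 hz).neg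
  have hbd : ∀ l : Filter ℝ, Tendsto (fun t => Complex.exp (-v t)) l (𝓝 0) →
      Tendsto (fun t => 1 / (z - γ t) * Complex.exp (-v t)) l (𝓝 0) := by
    intro l hl
    obtain ⟨δ, hδ, h⟩ := exists_pos_le_norm_sub hz
    refine squeeze_zero_norm (a := fun t => 1 / δ * ‖Complex.exp (-v t)‖) (fun t => ?_) ?_
    · rw [norm_mul, norm_div, norm_one]
      gcongr
      exact h z (Metric.mem_ball_self hδ) t
    · simpa using hl.norm.const_mul (1 / δ)
  have hparts : ∫ t, (-(1 / (z - γ t) * u t) - -(1 / (z - γ t) ^ 2) * w t) = 0 - 0 := by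
    refine integral_of_hasDerivAt_of_tendsto
      (f := fun t => 1 / (z - γ t) * Complex.exp (-v t)) (fun t => ?_) (hint'.sub hint)
      (hbd _ hγ.vanish_atBot) (hbd _ hγ.vanish_atTop)
    have h1 : HasDerivAt γ (deriv γ t) t :=
      (hγ.contDiff.differentiable (by norm_num) t).hasDerivAt
    have h2 : HasDerivAt (fun s => (z - γ s)⁻¹ * Complex.exp (-v s))
        (- -deriv γ t / (z - γ t) ^ 2 * Complex.exp (-v t) + (z - γ t)⁻¹ *
          (Complex.exp (-v t) * -(dV.eval (RingHom.id ℂ) (γ t) * deriv γ t))) t :=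
      ((h1.const_sub z).inv (hne t)).mul (hγ.hasDerivAt t).neg.cexp
    simp only [one_div]
    refine h2.congr_deriv ?_
    simp only [hu_def, w, arcWeight]
    ring
  have hω' : ∫ t, -(1 / (z - γ t) ^ 2) * w t = -cauchyIntegral γ u z := by
    rw [integral_sub hint' hint, integral_neg, sub_zero, sub_eq_zero] at hparts
    exact hparts.symm
  have hq : cauchyIntegral γ (fun t => dV.denom.eval (γ t) * u t) z
      = cauchyIntegral γ (fun t => dV.num.eval (γ t) * w t) z := by
    congr 1 with t
    simp only [hu_def, RatFunc.eval, eval₂_id]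
    have := hγ.denom_ne_zero t
    field_simp
  simp only [hω']
  have e1 := hr₁ z hz
  have e2 := hr₂ z hz
  rw [hq, e2] at e1
  rw [eval_sub]
  linear_combination e1

end IsAdmissibleArc

/-! ### Multi-affine functions -/

section Multiaffine

variable {ι : Type*}

/-- On `X`, the function `f` is a polynomial combination of the products `∏_{i ∈ T} ω(x_i)` with
`T ⊆ S`. The coefficients may involve all variables. -/
def IsPolyMultiaffine (X : Set (ι → ℂ)) (ω : ℂ → ℂ) (S : Finset ι) (f : (ι → ℂ) → ℂ) : Prop :=
  ∃ P : Finset ι → MvPolynomial ι ℂ, ∀ x ∈ X,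
    f x = ∑ T ∈ S.powerset, (P T).eval x * ∏ i ∈ T, ω (x i)

/-- On `X`, the function `f` is a combination of the products `∏_{i ∈ T} ω(x_i)` with `T ⊆ S`, whose
coefficients are rational functions with denominators that vanish nowhere on `X`. -/
def IsMultiaffine (X : Set (ι → ℂ)) (ω : ℂ → ℂ) (S : Finset ι) (f : (ι → ℂ) → ℂ) : Prop :=
  ∃ D : MvPolynomial ι ℂ, (∀ x ∈ X, D.eval x ≠ 0) ∧
    IsPolyMultiaffine X ω S fun x => D.eval x * f x

variable {X : Set (ι → ℂ)} {ω : ℂ → ℂ} {S S' T : Finset ι} {f g : (ι → ℂ) → ℂ}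

namespace IsPolyMultiaffine

theorem congr (hf : IsPolyMultiaffine X ω S f) (h : ∀ x ∈ X, g x = f x) :
    IsPolyMultiaffine X ω S g := by
  obtain ⟨P, hP⟩ := hf
  exact ⟨P, fun x hx => (h x hx).trans (hP x hx)⟩

theorem term (p : MvPolynomial ι ℂ) (h : T ⊆ S) :
    IsPolyMultiaffine X ω S fun x => p.eval x * ∏ i ∈ T, ω (x i) := by
  classical
  refine ⟨fun T' => if T' = T then p else 0, fun x _ => ?_⟩
  rw [Finset.sum_eq_single_of_mem T (Finset.mem_powerset.2 h)]
  · simp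
  · intro b _ hb
    simp [hb]

theorem sum {κ : Type*} (s : Finset κ) {F : κ → (ι → ℂ) → ℂ}
    (h : ∀ k ∈ s, IsPolyMultiaffine X ω S (F k)) :
    IsPolyMultiaffine X ω S fun x => ∑ k ∈ s, F k x := by
  classical
  have h' : ∀ k, ∃ P : Finset ι → MvPolynomial ι ℂ, k ∈ s → ∀ x ∈ X,
      F k x = ∑ T ∈ S.powerset, (P T).eval x * ∏ i ∈ T, ω (x i) := fun k => by
    by_cases hk : k ∈ s
    · obtain ⟨P, hP⟩ := h k hk
      exact ⟨P, fun _ => hP⟩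
    · exact ⟨0, fun h => absurd h hk⟩
  choose P hP using h'
  refine ⟨fun T => ∑ k ∈ s, P k T, fun x hx => ?_⟩
  simp only [map_sum, Finset.sum_mul]
  rw [Finset.sum_comm]
  exact Finset.sum_congr rfl fun k hk => hP k hk x hx

theorem mul [DecidableEq ι] (hf : IsPolyMultiaffine X ω S f) (hg : IsPolyMultiaffine X ω S' g)
    (hd : Disjoint S S') : IsPolyMultiaffine X ω (S ∪ S') fun x => f x * g x := by
  obtain ⟨P, hP⟩ := hf
  obtain ⟨Q, hQ⟩ := hg
  have h : IsPolyMultiaffine X ω (S ∪ S') fun x => ∑ T ∈ S.powerset, ∑ T' ∈ S'.powerset,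
      (P T * Q T').eval x * ∏ i ∈ T ∪ T', ω (x i) :=
    sum _ fun T hT => sum _ fun T' hT' => term _
      (Finset.union_subset_union (Finset.mem_powerset.1 hT) (Finset.mem_powerset.1 hT'))
  refine h.congr fun x hx => ?_
  rw [hP x hx, hQ x hx, Finset.sum_mul_sum]
  refine Finset.sum_congr rfl fun T hT => Finset.sum_congr rfl fun T' hT' => ?_
  rw [Finset.prod_union (Finset.disjoint_of_subset_left (Finset.mem_powerset.1 hT)
    (Finset.disjoint_of_subset_right (Finset.mem_powerset.1 hT') hd)), map_mul]
  ring

theorem eval_mul (p : MvPolynomial ι ℂ) (hf : IsPolyMultiaffine X ω S f) :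
    IsPolyMultiaffine X ω S fun x => p.eval x * f x := by
  obtain ⟨P, hP⟩ := hf
  refine ⟨fun T => p * P T, fun x hx => ?_⟩
  simp only [hP x hx, Finset.mul_sum, map_mul, mul_assoc]

theorem mono (hf : IsPolyMultiaffine X ω S f) (h : S ⊆ S') : IsPolyMultiaffine X ω S' f := by
  obtain ⟨P, hP⟩ := hf
  exact (sum _ fun T hT => term (P T) ((Finset.mem_powerset.1 hT).trans h)).congr hP

end IsPolyMultiaffine

namespace IsMultiaffine

theorem congr (hf : IsMultiaffine X ω S f) (h : ∀ x ∈ X, g x = f x) : IsMultiaffine X ω S g := by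
  obtain ⟨D, hD, hf⟩ := hf
  exact ⟨D, hD, hf.congr fun x hx => by rw [h x hx]⟩

theorem mono (hf : IsMultiaffine X ω S f) (h : S ⊆ S') : IsMultiaffine X ω S' f := by
  obtain ⟨D, hD, hf⟩ := hf
  exact ⟨D, hD, hf.mono h⟩

theorem eval (p : MvPolynomial ι ℂ) : IsMultiaffine X ω S fun x => p.eval x :=
  ⟨1, by simp, (IsPolyMultiaffine.term p (Finset.empty_subset S)).congr fun x _ => by simp⟩

theorem const (c : ℂ) : IsMultiaffine X ω S fun _ => c :=
  (eval (MvPolynomial.C c)).congr fun x _ => by simp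

/-- A factor that vanishes nowhere on `X` may be divided out. -/
theorem of_eval_mul {D : MvPolynomial ι ℂ} (hD : ∀ x ∈ X, D.eval x ≠ 0)
    (hf : IsMultiaffine X ω S fun x => D.eval x * f x) : IsMultiaffine X ω S f := by
  obtain ⟨E, hE, hf⟩ := hf
  refine ⟨E * D, fun x hx => ?_, hf.congr fun x _ => ?_⟩
  · rw [map_mul]
    exact mul_ne_zero (hE x hx) (hD x hx)
  · rw [map_mul, mul_assoc]

theorem mul [DecidableEq ι] (hf : IsMultiaffine X ω S f) (hg : IsMultiaffine X ω S' g)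
    (hd : Disjoint S S') : IsMultiaffine X ω (S ∪ S') fun x => f x * g x := by
  obtain ⟨D, hD, hf⟩ := hf
  obtain ⟨E, hE, hg⟩ := hg
  refine ⟨D * E, fun x hx => ?_, (hf.mul hg hd).congr fun x _ => ?_⟩
  · rw [map_mul]
    exact mul_ne_zero (hD x hx) (hE x hx)
  · rw [map_mul]
    ring

theorem const_mul (c : ℂ) (hf : IsMultiaffine X ω S f) :
    IsMultiaffine X ω S fun x => c * f x := by
  classical
  simpa using (const (S := ∅) c).mul hf (Finset.disjoint_empty_left S)

theorem add (hf : IsMultiaffine X ω S f) (hg : IsMultiaffine X ω S g) :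
    IsMultiaffine X ω S fun x => f x + g x := by
  obtain ⟨D, hD, hf⟩ := hf
  obtain ⟨E, hE, hg⟩ := hg
  refine ⟨D * E, fun x hx => ?_, (IsPolyMultiaffine.sum Finset.univ
    (F := fun b : Bool => if b then fun x => E.eval x * (D.eval x * f x)
      else fun x => D.eval x * (E.eval x * g x)) fun b _ => ?_).congr fun x _ => ?_⟩
  · rw [map_mul]
    exact mul_ne_zero (hD x hx) (hE x hx)
  · cases b
    · simpa using hg.eval_mul D
    · simpa using hf.eval_mul E
  · simp only [map_mul, Fintype.sum_bool, if_true, Bool.false_eq_true, if_false]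
    ring

theorem sub (hf : IsMultiaffine X ω S f) (hg : IsMultiaffine X ω S g) :
    IsMultiaffine X ω S fun x => f x - g x :=
  (hf.add (hg.const_mul (-1))).congr fun x _ => by ring

theorem sum {κ : Type*} (s : Finset κ) {F : κ → (ι → ℂ) → ℂ}
    (h : ∀ k ∈ s, IsMultiaffine X ω S (F k)) : IsMultiaffine X ω S fun x => ∑ k ∈ s, F k x := by
  classical
  induction s using Finset.induction_on with
  | empty => simpa using const (X := X) (ω := ω) (S := S) 0
  | insert a s ha ih =>
    simp only [Finset.sum_insert ha]
    exact (h a (Finset.mem_insert_self a s)).add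
      (ih fun k hk => h k (Finset.mem_insert_of_mem hk))

theorem prod [DecidableEq ι] {κ : Type*} (s : Finset κ) {A : κ → Finset ι}
    {F : κ → (ι → ℂ) → ℂ} (h : ∀ k ∈ s, IsMultiaffine X ω (A k) (F k))
    (hd : (s : Set κ).PairwiseDisjoint A) :
    IsMultiaffine X ω (s.biUnion A) fun x => ∏ k ∈ s, F k x := by
  classical
  induction s using Finset.induction_on with
  | empty => simpa using const (X := X) (ω := ω) (S := ∅) 1
  | insert a s ha ih =>
    simp only [Finset.prod_insert ha, Finset.biUnion_insert]
    refine (h a (Finset.mem_insert_self a s)).mul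
      (ih (fun k hk => h k (Finset.mem_insert_of_mem hk)) (hd.subset (by simp))) ?_
    rw [Finset.disjoint_biUnion_right]
    exact fun k hk => hd (by simp) (by simp [hk]) (by rintro rfl; exact ha hk)

/-- Cumulants inherit multi-affinity from the moments, because the blocks of a partition involve
disjoint sets of variables. -/
theorem cumulant [DecidableEq ι] {m : (ι → ℂ) → Finset ι → ℂ}
    (hm : ∀ S, IsMultiaffine X ω S fun x => m x S) (S : Finset ι) :
    IsMultiaffine X ω S fun x => cumulant (m x) S := by
  induction S using Finset.strongInduction with
  | H S ih =>
    refine ((hm S).sub (sum Finset.univ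
      (F := fun (π : {π : Finpartition S // S ∉ π.parts}) x =>
        ∏ B : {B // B ∈ π.1.parts}, _root_.cumulant (m x) B.1) fun π _ => ?_)).congr
      fun x _ => by rw [_root_.cumulant]
    refine (prod Finset.univ (A := fun B : {B // B ∈ π.1.parts} => B.1) (fun B _ => ?_)
      fun B _ C _ hBC => π.1.disjoint B.2 C.2 fun h => hBC (Subtype.ext h)).mono ?_
    · exact ih B.1 (lt_of_le_of_ne (π.1.le B.2) fun h => π.2 (by simpa [h] using B.2))
    · exact Finset.biUnion_subset.2 fun B _ => π.1.le B.2

end IsMultiaffine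

end Multiaffine

/-! ### Linear relations over a ring of polynomials -/

section RationalSpan

variable {n : ℕ} {R : Type*} [CommRing R] {ι : Type*} [Fintype ι]

/-- On `X`, the function `f` lies in the span of the functions `b i` over the fraction field of `R`,
whose elements are seen as functions of `x` through the evaluation maps `ev x`. -/
def InRationalSpan {E : Type*} (ev : E → R →+* ℂ) (b : ι → E → ℂ) (X : Set E) (f : E → ℂ) :
    Prop :=
  ∃ d : R, d ≠ 0 ∧ ∃ p : ι → R, ∀ x ∈ X, ev x d * f x = ∑ i, ev x (p i) * b i x

/-- More functions than the dimension of their span satisfy a linear relation. -/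
theorem exists_linear_relation [IsDomain R] {E : Type*} {ev : E → R →+* ℂ} {b : ι → E → ℂ}
    {X : Set E} {k : ℕ} (hk : Fintype.card ι < k) {f : Fin k → E → ℂ}
    (hf : ∀ j, InRationalSpan ev b X (f j)) :
    ∃ C : Fin k → R, C ≠ 0 ∧ ∀ x ∈ X, ∑ j, ev x (C j) * f j x = 0 := by
  choose d hd p hp using hf
  have hdep : ¬LinearIndependent R p := fun h => by
    have := h.fintype_card_le_finrank
    simp only [Fintype.card_fin, Module.finrank_fintype_fun_eq_card] at this
    omega
  obtain ⟨c, hc, j, hj⟩ := Fintype.not_linearIndependent_iff.1 hdep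
  refine ⟨fun j => c j * d j, fun h => mul_ne_zero hj (hd j) (congrFun h j), fun x hx => ?_⟩
  calc ∑ j, ev x (c j * d j) * f j x = ∑ j, ∑ i, ev x (c j * p j i) * b i x := by
        refine Finset.sum_congr rfl fun j _ => ?_
        rw [map_mul, mul_assoc, hp j x hx, Finset.mul_sum]
        exact Finset.sum_congr rfl fun i _ => by rw [map_mul, mul_assoc]
    _ = ∑ i, ev x ((∑ j, c j • p j) i) * b i x := by
        rw [Finset.sum_comm]
        refine Finset.sum_congr rfl fun i _ => ?_
        simp [Finset.sum_apply, Finset.sum_mul]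
    _ = 0 := by rw [hc]; simp

/-- The line through `x` in the direction of the first variable. -/
def firstLine (x : Fin (n + 1) → ℂ) (s : ℂ) : Fin (n + 1) → ℂ := Fin.cons s (Fin.tail x)

@[simp]
theorem firstLine_self (x : Fin (n + 1) → ℂ) : firstLine x (x 0) = x := Fin.cons_self_tail x

@[simp]
theorem firstLine_firstLine (x : Fin (n + 1) → ℂ) (s : ℂ) :
    firstLine (firstLine x s) = firstLine x := by
  ext; simp [firstLine]

@[simp]
theorem firstLine_zero (x : Fin (n + 1) → ℂ) (s : ℂ) : firstLine x s 0 = s := rfl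

@[simp]
theorem firstLine_succ (x : Fin (n + 1) → ℂ) (s : ℂ) (i : Fin n) :
    firstLine x s i.succ = x i.succ := rfl

variable [IsDomain R] {ev : (Fin (n + 1) → ℂ) → R →+* ℂ} {b : ι → (Fin (n + 1) → ℂ) → ℂ}
  {X : Set (Fin (n + 1) → ℂ)}

/-- If the basis functions satisfy a linear first-order differential system over the fraction field,
then the span is stable under differentiation in the first variable. -/
theorem InRationalSpan.deriv {δ : R → R} {e : R} {a : ι → ι → R}
    {b' : ι → (Fin (n + 1) → ℂ) → ℂ} {f : (Fin (n + 1) → ℂ) → ℂ}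
    (hX : ∀ x ∈ X, ∀ᶠ s in 𝓝 (x 0), firstLine x s ∈ X)
    (hev : ∀ r, ∀ x ∈ X, HasDerivAt (fun s => ev (firstLine x s) r) (ev x (δ r)) (x 0))
    (hb : ∀ i, ∀ x ∈ X, HasDerivAt (fun s => b i (firstLine x s)) (b' i x) (x 0))
    (he : e ≠ 0) (hb' : ∀ i, ∀ x ∈ X, ev x e * b' i x = ∑ j, ev x (a i j) * b j x)
    (hf : InRationalSpan ev b X f)
    (hfd : ∀ x ∈ X, DifferentiableAt ℂ (fun s => f (firstLine x s)) (x 0)) :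
    InRationalSpan ev b X fun x => deriv (fun s => f (firstLine x s)) (x 0) := by
  obtain ⟨d, hd, p, hp⟩ := hf
  -- differentiate `d f = ∑ p_i b_i`, multiply by `e d` and replace `d f` and the `e b'_i`
  refine ⟨e * d * d, mul_ne_zero (mul_ne_zero he hd) hd,
    fun j => d * (e * δ (p j) + ∑ i, p i * a i j) - e * δ d * p j, fun x hx => ?_⟩
  have h1 : HasDerivAt (fun s => ev (firstLine x s) d * f (firstLine x s))
      (ev x (δ d) * f x + ev x d * _root_.deriv (fun s => f (firstLine x s)) (x 0)) (x 0) := by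
    simpa using (hev d x hx).fun_mul (hfd x hx).hasDerivAt
  have h2 : HasDerivAt (fun s => ∑ i, ev (firstLine x s) (p i) * b i (firstLine x s))
      (∑ i, (ev x (δ (p i)) * b i x + ev x (p i) * b' i x)) (x 0) :=
    HasDerivAt.fun_sum fun i _ => by simpa using (hev (p i) x hx).fun_mul (hb i x hx)
  have h3 := h1.unique (h2.congr_of_eventuallyEq ((hX x hx).mono fun s hs => hp _ hs))
  have h4 : ev x e * ∑ i, ev x (p i) * b' i x = ∑ j, ev x (∑ i, p i * a i j) * b j x := by
    simp only [map_sum, map_mul, Finset.sum_mul]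
    rw [Finset.sum_comm, Finset.mul_sum]
    refine Finset.sum_congr rfl fun i _ => ?_
    rw [mul_left_comm, hb' i x hx, Finset.mul_sum]
    exact Finset.sum_congr rfl fun j _ => by ring
  have h5 : ∑ j, ev x (d * (e * δ (p j) + ∑ i, p i * a i j) - e * δ d * p j) * b j x
      = ev x d * (ev x e * ∑ j, ev x (δ (p j)) * b j x)
        + ev x d * ∑ j, ev x (∑ i, p i * a i j) * b j x
        - ev x e * ev x (δ d) * ∑ j, ev x (p j) * b j x := by
    simp only [Finset.mul_sum, ← Finset.sum_add_distrib, ← Finset.sum_sub_distrib]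
    refine Finset.sum_congr rfl fun j _ => ?_
    rw [map_sub, map_mul, map_add, map_mul, map_mul, map_mul]
    ring
  rw [h5, ← h4, ← hp x hx]
  rw [Finset.sum_add_distrib] at h3
  simp only [map_mul]
  linear_combination ev x d * ev x e * h3

theorem InRationalSpan.iteratedDeriv {δ : R → R} {e : R} {a : ι → ι → R}
    {b' : ι → (Fin (n + 1) → ℂ) → ℂ} {f : (Fin (n + 1) → ℂ) → ℂ}
    (hX : ∀ x ∈ X, ∀ᶠ s in 𝓝 (x 0), firstLine x s ∈ X)
    (hev : ∀ r, ∀ x ∈ X, HasDerivAt (fun s => ev (firstLine x s) r) (ev x (δ r)) (x 0))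
    (hb : ∀ i, ∀ x ∈ X, HasDerivAt (fun s => b i (firstLine x s)) (b' i x) (x 0))
    (he : e ≠ 0) (hb' : ∀ i, ∀ x ∈ X, ev x e * b' i x = ∑ j, ev x (a i j) * b j x)
    (hf : InRationalSpan ev b X f)
    (hfa : ∀ x ∈ X, AnalyticAt ℂ (fun s => f (firstLine x s)) (x 0)) (k : ℕ) :
    InRationalSpan ev b X fun x => iteratedDeriv k (fun s => f (firstLine x s)) (x 0) := by
  induction k with
  | zero => simpa using hf
  | succ k ih =>
    have h := ih.deriv hX hev hb he hb' fun x hx => by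
      simp only [firstLine_firstLine, firstLine_zero, iteratedDeriv_eq_iterate]
      exact ((hfa x hx).iterated_deriv k).differentiableAt
    simpa only [firstLine_firstLine, firstLine_zero, iteratedDeriv_succ] using h

end RationalSpan

/-! ### Moments and correlators are multi-affine in the Stieltjes transform -/

section Moments

variable {dV : RatFunc ℂ} {γ v : ℝ → ℂ} {n : ℕ}

theorem MvPolynomial.eval_aeval_X {σ : Type*} (x : σ → ℂ) (i : σ) (r : ℂ[X]) :
    MvPolynomial.eval x (Polynomial.aeval (MvPolynomial.X i) r) = r.eval (x i) := by
  rw [Polynomial.aeval_def, Polynomial.hom_eval₂, MvPolynomial.eval_X,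
    ← Polynomial.eval₂_id (p := r)]
  congr 1
  ext a
  simp [MvPolynomial.algebraMap_eq]

theorem IsAdmissibleArc.integrable_pow_mul_prod (hγ : IsAdmissibleArc dV γ v) (e : ℕ)
    {x : Fin n → ℂ} (hx : ∀ i, x i ∉ closure (Set.range γ)) (B : Finset (Fin n)) :
    Integrable fun t => γ t ^ e * (∏ i ∈ B, 1 / (x i - γ t)) * arcWeight γ v t := by
  induction B using Finset.induction_on with
  | empty =>
    have h : Integrable fun t => ((X : ℂ[X]) ^ e).eval (γ t) * arcWeight γ v t :=
      hγ.integrable (X ^ e)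
    simpa using h
  | insert i B hi ih =>
    refine (integrable_cauchyKernel_mul hγ.continuous ih (hx i)).congr (.of_forall fun t => ?_)
    simp only [Finset.prod_insert hi]
    ring

/-- One-dimensional integrals are multi-affine: partial fractions reduce a product of Cauchy
kernels to a single one. -/
theorem IsAdmissibleArc.isMultiaffine_integral (hγ : IsAdmissibleArc dV γ v) (e : ℕ)
    (B : Finset (Fin n)) :
    IsMultiaffine (configurations γ n) (cauchyIntegral γ (arcWeight γ v)) B fun x =>
      ∫ t, γ t ^ e * (∏ i ∈ B, 1 / (x i - γ t)) * arcWeight γ v t := by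
  induction B using Finset.strongInduction with
  | H B ih =>
    rcases B.eq_empty_or_nonempty with rfl | ⟨i, hi⟩
    · simpa using IsMultiaffine.const _
    by_cases hB : B = {i}
    · subst hB
      have hw : ∀ f : ℂ[X], Integrable fun t => f.eval (γ t) * arcWeight γ v t := hγ.integrable
      obtain ⟨r, hr⟩ := exists_cauchyIntegral_eval_mul hγ.continuous hw (X ^ e)
      have h1 : IsMultiaffine (configurations γ n) (cauchyIntegral γ (arcWeight γ v)) {i}
          fun x => (MvPolynomial.X i ^ e).eval x
            * ∏ j ∈ {i}, cauchyIntegral γ (arcWeight γ v) (x j) :=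
        ⟨1, by simp, (IsPolyMultiaffine.term (MvPolynomial.X i ^ e) (Finset.Subset.refl {i})).congr
          fun x _ => by simp⟩
      refine (h1.add (IsMultiaffine.eval (Polynomial.aeval (MvPolynomial.X i) r))).congr
        fun x hx => ?_
      have := hr (x i) (hx.2 i)
      simp only [MvPolynomial.eval_aeval_X, map_pow, MvPolynomial.eval_X, Finset.prod_singleton]
      rw [eval_pow, eval_X] at this
      rw [← this, cauchyIntegral]
      congr 1 with t
      rw [eval_pow, eval_X]
      ring
    · obtain ⟨k, hk, hki⟩ : ∃ k ∈ B, k ≠ i := by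
        by_contra! h
        exact hB (Finset.eq_singleton_iff_unique_mem.2 ⟨hi, h⟩)
      have hD : ∀ x ∈ configurations γ n,
          (MvPolynomial.X k - MvPolynomial.X i : MvPolynomial (Fin n) ℂ).eval x ≠ 0 := by
        intro x hx
        rw [map_sub, MvPolynomial.eval_X, MvPolynomial.eval_X, sub_ne_zero]
        exact fun h => hki (hx.1 h)
      refine IsMultiaffine.of_eval_mul hD ((((ih _ (Finset.erase_ssubset hk)).mono
        (Finset.erase_subset k B)).sub ((ih _ (Finset.erase_ssubset hi)).mono
        (Finset.erase_subset i B))).congr fun x hx => ?_)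
      rw [← integral_sub (hγ.integrable_pow_mul_prod e hx.2 _)
        (hγ.integrable_pow_mul_prod e hx.2 _), ← integral_const_mul]
      congr 1 with t
      rw [← Finset.mul_prod_erase B _ hi,
        ← Finset.mul_prod_erase (B.erase i) _ (Finset.mem_erase.2 ⟨hki, hk⟩),
        ← Finset.mul_prod_erase (B.erase k) _ (Finset.mem_erase.2 ⟨hki.symm, hi⟩),
        Finset.erase_right_comm (a := k)]
      have h1 := sub_ne_zero_of_notMem_closure (hx.2 i) t
      have h2 := sub_ne_zero_of_notMem_closure (hx.2 k) t
      simp only [map_sub, MvPolynomial.eval_X]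
      field_simp
      ring

theorem exists_eval_eq_vandermondeProd_sq (N : ℕ) :
    ∃ Q : MvPolynomial (Fin N) ℂ, ∀ l, Q.eval l = vandermondeProd l ^ 2 :=
  ⟨(∏ i, ∏ j ∈ Finset.Ioi i, (MvPolynomial.X i - MvPolynomial.X j)) ^ 2, fun l => by
    simp [vandermondeProd, map_prod]⟩

/-- The eigenvalues interact only through the polynomial `Δ(Λ)²`. Expanding it and the product of
the traces, the moment becomes a sum of products of one-dimensional integrals, which involve
disjoint sets of the variables `x_i`. -/
theorem IsAdmissibleArc.isMultiaffine_eigenIntegral (hγ : IsAdmissibleArc dV γ v) (N : ℕ)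
    (S : Finset (Fin n)) :
    IsMultiaffine (configurations γ n) (cauchyIntegral γ (arcWeight γ v)) S fun x =>
      eigenIntegral γ v N fun l => ∏ i ∈ S, ∑ j, 1 / (x i - l j) := by
  obtain ⟨Q, hQ⟩ := exists_eval_eq_vandermondeProd_sq N
  -- the variables assigned to the eigenvalue `j` by the term `f` of the expansion
  let A : (S → Fin N) → Fin N → Finset (Fin n) := fun f j =>
    (Finset.univ.filter fun i => f i = j).map (Function.Embedding.subtype _)
  have hA : ∀ f, (Finset.univ : Finset (Fin N)).biUnion (A f) ⊆ S := fun f =>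
    Finset.biUnion_subset.2 fun j _ i hi => by
      obtain ⟨k, _, rfl⟩ := Finset.mem_map.1 hi
      exact k.2
  have hdisj : ∀ f, ((Finset.univ : Finset (Fin N)) : Set (Fin N)).PairwiseDisjoint (A f) := by
    intro f j _ k _ hjk
    refine (Finset.disjoint_map _).2 (Finset.disjoint_left.2 fun i hi hi' => hjk ?_)
    rw [Finset.mem_filter] at hi hi'
    exact hi.2.symm.trans hi'.2
  have key : IsMultiaffine (configurations γ n) (cauchyIntegral γ (arcWeight γ v)) S fun x =>
      ∑ f : S → Fin N, ∑ d ∈ Q.support, Q.coeff d *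
        ∏ j, ∫ t, γ t ^ d j * (∏ i ∈ A f j, 1 / (x i - γ t)) * arcWeight γ v t :=
    IsMultiaffine.sum _ fun f _ => IsMultiaffine.sum _ fun d _ => IsMultiaffine.const_mul _
      ((IsMultiaffine.prod _ (fun j _ => hγ.isMultiaffine_integral (d j) (A f j))
        (hdisj f)).mono (hA f))
  refine key.congr fun x hx => ?_
  have hint : ∀ (f : S → Fin N) (d : Fin N →₀ ℕ), Integrable fun t : Fin N → ℝ => Q.coeff d *
      ∏ j, (γ (t j) ^ d j * (∏ i ∈ A f j, 1 / (x i - γ (t j))) * arcWeight γ v (t j)) :=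
    fun f d => (Integrable.fintype_prod
      (f := fun j t => γ t ^ d j * (∏ i ∈ A f j, 1 / (x i - γ t)) * arcWeight γ v t)
      fun j => hγ.integrable_pow_mul_prod (d j) hx.2 (A f j)).const_mul _
  have hexp : ∀ l : Fin N → ℂ, ∏ i ∈ S, ∑ j, 1 / (x i - l j)
      = ∑ f : S → Fin N, ∏ j, ∏ i ∈ A f j, 1 / (x i - l j) := by
    intro l
    rw [← Finset.prod_coe_sort, Finset.prod_univ_sum, Fintype.piFinset_univ]
    refine Finset.sum_congr rfl fun f _ => ?_
    rw [← Finset.prod_fiberwise Finset.univ f]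
    refine Finset.prod_congr rfl fun j _ => ?_
    rw [Finset.prod_map]
    refine Finset.prod_congr rfl fun i hi => ?_
    rw [(Finset.mem_filter.1 hi).2]
    rfl
  calc eigenIntegral γ v N (fun l => ∏ i ∈ S, ∑ j, 1 / (x i - l j))
      = ∫ t : Fin N → ℝ, ∑ f : S → Fin N, ∑ d ∈ Q.support, Q.coeff d *
        ∏ j, (γ (t j) ^ d j * (∏ i ∈ A f j, 1 / (x i - γ (t j))) * arcWeight γ v (t j)) := by
        rw [eigenIntegral]
        congr 1 with t
        rw [hexp, ← hQ, MvPolynomial.eval_eq', Finset.sum_mul, Finset.sum_mul]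
        refine Finset.sum_congr rfl fun f _ => ?_
        rw [Finset.mul_sum, Finset.sum_mul]
        refine Finset.sum_congr rfl fun d _ => ?_
        simp only [Finset.prod_mul_distrib, arcWeight]
        ring
    _ = _ := by
        rw [integral_finsetSum _ fun f _ => integrable_finsetSum _ fun d _ => hint f d]
        refine Finset.sum_congr rfl fun f _ => ?_
        rw [integral_finsetSum _ fun d _ => hint f d]
        refine Finset.sum_congr rfl fun d _ => ?_
        rw [integral_const_mul, integral_fintype_prod_volume_eq_prod
          (fun j t => γ t ^ d j * (∏ i ∈ A f j, 1 / (x i - γ t)) * arcWeight γ v t)]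

theorem IsAdmissibleArc.isMultiaffine_resolventMoment (hγ : IsAdmissibleArc dV γ v) (N : ℕ)
    (S : Finset (Fin n)) :
    IsMultiaffine (configurations γ n) (cauchyIntegral γ (arcWeight γ v)) S fun x =>
      resolventMoment γ v N x S :=
  (hγ.isMultiaffine_eigenIntegral N S).const_mul _

theorem isMultiaffine_doublePole (γ : ℝ → ℂ) (ω : ℂ → ℂ) (S : Finset (Fin n)) :
    IsMultiaffine (configurations γ n) ω S fun x => doublePole x S := by
  unfold doublePole
  split_ifs
  · refine IsMultiaffine.sum _ fun i _ => IsMultiaffine.sum _ fun j hj => ?_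
    have hij : i ≠ j := (Finset.mem_filter.1 hj).2.ne
    have hne : ∀ x ∈ configurations γ n, x i - x j ≠ 0 := fun x hx =>
      sub_ne_zero.2 fun h => hij (hx.1 h)
    refine IsMultiaffine.of_eval_mul (D := (MvPolynomial.X i - MvPolynomial.X j) ^ 2)
      (fun x hx => by simpa using hne x hx) ((IsMultiaffine.const 1).congr fun x hx => ?_)
    have := hne x hx
    simp only [map_pow, map_sub, MvPolynomial.eval_X]
    field_simp
  · exact IsMultiaffine.const 0

theorem IsAdmissibleArc.isMultiaffine_correlator (hγ : IsAdmissibleArc dV γ v) (N : ℕ) :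
    IsMultiaffine (configurations γ n) (cauchyIntegral γ (arcWeight γ v)) Finset.univ
      (correlator γ v n N) :=
  (IsMultiaffine.cumulant (hγ.isMultiaffine_resolventMoment N) _).add
    (isMultiaffine_doublePole γ _ _)

theorem IsAdmissibleArc.isMultiaffine_shiftedCorrelator (hγ : IsAdmissibleArc dV γ v) (N : ℕ) :
    IsMultiaffine (configurations γ n) (cauchyIntegral γ (arcWeight γ v)) Finset.univ
      (shiftedCorrelator γ v n N) :=
  IsMultiaffine.cumulant (m := fun x S => doublePole x S + resolventMoment γ v N x S)
    (fun S => (isMultiaffine_doublePole γ _ S).add (hγ.isMultiaffine_resolventMoment N S)) _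

end Moments

/-! ### Analyticity, recursions and differential equations -/

section Relations

variable {γ : ℝ → ℂ} {n : ℕ}

theorem eventually_firstLine_mem_configurations {x : Fin (n + 1) → ℂ}
    (hx : x ∈ configurations γ (n + 1)) :
    ∀ᶠ s in 𝓝 (x 0), firstLine x s ∈ configurations γ (n + 1) := by
  have hinj := hx.1
  rw [← Fin.cons_self_tail x, Fin.cons_injective_iff] at hinj
  have h1 : ∀ᶠ s in 𝓝 (x 0), s ∉ Set.range (Fin.tail x) :=
    (Set.finite_range _).isClosed.isOpen_compl.mem_nhds hinj.1
  have h2 : ∀ᶠ s in 𝓝 (x 0), s ∉ closure (Set.range γ) :=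
    isClosed_closure.isOpen_compl.mem_nhds (hx.2 0)
  filter_upwards [h1, h2] with s hs1 hs2
  exact ⟨Fin.cons_injective_iff.2 ⟨hs1, hinj.2⟩, fun i => Fin.cases hs2 (fun j => hx.2 j.succ) i⟩

theorem hasDerivAt_eval_firstLine (r : MvPolynomial (Fin (n + 1)) ℂ) (x : Fin (n + 1) → ℂ) :
    HasDerivAt (fun s => MvPolynomial.eval (firstLine x s) r)
      (MvPolynomial.eval x (MvPolynomial.pderiv 0 r)) (x 0) := by
  induction r using MvPolynomial.induction_on with
  | C a => simpa using hasDerivAt_const (x 0) a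
  | add p q hp hq => simpa only [map_add] using hp.fun_add hq
  | mul_X p i hp =>
    have hX : HasDerivAt (fun s => MvPolynomial.eval (firstLine x s) (MvPolynomial.X i))
        (MvPolynomial.eval x (MvPolynomial.pderiv 0 (MvPolynomial.X i))) (x 0) := by
      refine Fin.cases ?_ (fun j => ?_) i
      · simpa using hasDerivAt_id' (x 0)
      · simpa [MvPolynomial.pderiv_X_of_ne (Fin.succ_ne_zero j)] using
          hasDerivAt_const (x 0) (x j.succ)
    have h := hp.fun_mul hX
    simp only [← map_mul, firstLine_self] at h
    refine h.congr_deriv ?_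
    rw [Derivation.leibniz, smul_eq_mul, smul_eq_mul]
    simp only [map_add, map_mul]
    ring

variable {ω ω' : ℂ → ℂ} {f : (Fin (n + 1) → ℂ) → ℂ}

theorem hasDerivAt_prod_firstLine (hω : ∀ z ∉ closure (Set.range γ), HasDerivAt ω (ω' z) z)
    {x : Fin (n + 1) → ℂ} (hx : x ∈ configurations γ (n + 1)) (T : Finset (Fin (n + 1))) :
    HasDerivAt (fun s => ∏ i ∈ T, ω (firstLine x s i))
      (if 0 ∈ T then ω' (x 0) * ∏ i ∈ T.erase 0, ω (x i) else 0) (x 0) := by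
  have hrest : ∀ T : Finset (Fin (n + 1)), 0 ∉ T → ∀ s,
      ∏ i ∈ T, ω (firstLine x s i) = ∏ i ∈ T, ω (x i) := fun T hT s =>
    Finset.prod_congr rfl fun i hi => by
      obtain ⟨j, rfl⟩ := Fin.exists_succ_eq.2 (ne_of_mem_of_not_mem hi hT)
      rw [firstLine_succ]
  split_ifs with h
  · have h1 := (hω _ (hx.2 0)).mul_const (∏ i ∈ T.erase 0, ω (x i))
    refine h1.congr_of_eventuallyEq (.of_forall fun s => ?_)
    simp only
    rw [← Finset.mul_prod_erase T _ h, hrest _ (Finset.notMem_erase 0 T), firstLine_zero]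
  · simp only [hrest T h]
    exact hasDerivAt_const _ _

theorem IsMultiaffine.differentiableAt_firstLine
    (hω : ∀ z ∉ closure (Set.range γ), HasDerivAt ω (ω' z) z)
    (hf : IsMultiaffine (configurations γ (n + 1)) ω Finset.univ f) {x : Fin (n + 1) → ℂ}
    (hx : x ∈ configurations γ (n + 1)) :
    DifferentiableAt ℂ (fun s => f (firstLine x s)) (x 0) := by
  obtain ⟨D, hD, P, hP⟩ := hf
  have h : DifferentiableAt ℂ (fun s => (∑ T ∈ Finset.univ.powerset,
      MvPolynomial.eval (firstLine x s) (P T) * ∏ i ∈ T, ω (firstLine x s i)) /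
        MvPolynomial.eval (firstLine x s) D) (x 0) := by
    refine DifferentiableAt.fun_div (DifferentiableAt.fun_sum fun T _ => ?_)
      (hasDerivAt_eval_firstLine D x).differentiableAt (by simpa using hD x hx)
    exact (hasDerivAt_eval_firstLine (P T) x).differentiableAt.fun_mul
      (hasDerivAt_prod_firstLine hω hx T).differentiableAt
  refine h.congr_of_eventuallyEq ?_
  filter_upwards [eventually_firstLine_mem_configurations hx] with s hs
  rw [← hP _ hs, mul_div_cancel_left₀ _ (hD _ hs)]

theorem IsMultiaffine.analyticAt_firstLine
    (hω : ∀ z ∉ closure (Set.range γ), HasDerivAt ω (ω' z) z)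
    (hf : IsMultiaffine (configurations γ (n + 1)) ω Finset.univ f) {x : Fin (n + 1) → ℂ}
    (hx : x ∈ configurations γ (n + 1)) :
    AnalyticAt ℂ (fun s => f (firstLine x s)) (x 0) := by
  rw [Complex.analyticAt_iff_eventually_differentiableAt]
  filter_upwards [eventually_firstLine_mem_configurations hx] with s hs
  simpa using hf.differentiableAt_firstLine hω hs

theorem IsMultiaffine.inRationalSpan
    (hf : IsMultiaffine (configurations γ (n + 1)) ω Finset.univ f)
    (hne : (configurations γ (n + 1)).Nonempty) :
    InRationalSpan (fun x => MvPolynomial.eval x)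
      (fun (T : Finset (Fin (n + 1))) x => ∏ i ∈ T, ω (x i)) (configurations γ (n + 1)) f := by
  obtain ⟨D, hD, P, hP⟩ := hf
  obtain ⟨x, hx⟩ := hne
  refine ⟨D, ?_, P, fun x hx => ?_⟩
  · rintro rfl
    exact hD x hx (map_zero _)
  · simpa using hP x hx

/-- For fixed `x_2, …, x_n`, a multi-affine function is a combination of `1` and `ω(x_1)` over the
rational functions of `x_1`. -/
theorem IsMultiaffine.inRationalSpan_fiber
    (hf : IsMultiaffine (configurations γ (n + 1)) ω Finset.univ f) {y : Fin n → ℂ}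
    (hne : (configurations γ (n + 1) ∩ {x | Fin.tail x = y}).Nonempty) :
    InRationalSpan (fun x : Fin (n + 1) → ℂ => Polynomial.evalRingHom (x 0))
      (fun (c : Bool) x => if c then ω (x 0) else 1)
      (configurations γ (n + 1) ∩ {x | Fin.tail x = y}) f := by
  obtain ⟨D, hD, P, hP⟩ := hf
  let φ : MvPolynomial (Fin (n + 1)) ℂ →ₐ[ℂ] ℂ[X] :=
    MvPolynomial.aeval (Fin.cons X fun i => C (y i) : Fin (n + 1) → ℂ[X])
  have hφ : ∀ x ∈ configurations γ (n + 1) ∩ {x | Fin.tail x = y}, ∀ p,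
      (φ p).eval (x 0) = MvPolynomial.eval x p := by
    rintro x ⟨-, rfl⟩ p
    induction p using MvPolynomial.induction_on with
    | C a => simp [φ]
    | add p q hp hq => rw [map_add, eval_add, hp, hq, map_add]
    | mul_X p i hp =>
      rw [map_mul, eval_mul, hp, map_mul, MvPolynomial.eval_X]
      congr 1
      refine Fin.cases ?_ (fun j => ?_) i <;> simp [φ, Fin.tail]
  -- the value of `∏_{i ∈ T} ω(x_i)` without the factor of `x_1`; the entry `0` put in place of `x_1` is not used
  let c : Finset (Fin (n + 1)) → ℂ := fun T =>
    ∏ i ∈ T.erase 0, ω ((Fin.cons 0 y : Fin (n + 1) → ℂ) i)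
  refine ⟨φ D, ?_, fun b => ∑ T with decide (0 ∈ T) = b, C (c T) * φ (P T), fun x hx => ?_⟩
  · obtain ⟨x, hx⟩ := hne
    intro h
    apply hD x hx.1
    rw [← hφ x hx, h, eval_zero]
  · have hc : ∀ T, ∏ i ∈ T, ω (x i) = c T * if 0 ∈ T then ω (x 0) else 1 := by
      intro T
      have h1 : c T = ∏ i ∈ T.erase 0, ω (x i) := Finset.prod_congr rfl fun i hi => by
        obtain ⟨j, rfl⟩ := Fin.exists_succ_eq.2 (Finset.ne_of_mem_erase hi)
        rw [Fin.cons_succ, ← hx.2]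
        rfl
      rw [h1]
      split_ifs with h
      · rw [Finset.prod_erase_mul _ _ h]
      · rw [Finset.erase_eq_of_notMem h, mul_one]
    simp only [coe_evalRingHom, eval_finsetSum, eval_mul, eval_C, hφ x hx]
    refine (hP x hx.1).trans ?_
    rw [Finset.powerset_univ,
      ← Finset.sum_fiberwise Finset.univ (fun T => decide (0 ∈ T))]
    refine Finset.sum_congr rfl fun b _ => ?_
    rw [Finset.sum_mul]
    refine Finset.sum_congr rfl fun T hT => ?_
    rw [hc T, ← (Finset.mem_filter.1 hT).2]
    simp only [decide_eq_true_eq]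
    ring

variable {p q r : ℂ[X]}

/-- The derivative of `∏_{i ∈ T} ω(x_i)` vanishes if `0 ∉ T`; otherwise the equation `q ω' = -p ω + r`
expresses it through the products over `T` and over `T \ {0}`. -/
theorem IsMultiaffine.inRationalSpan_iteratedDeriv (hq : q ≠ 0)
    (hω : ∀ z ∉ closure (Set.range γ), HasDerivAt ω (ω' z) z)
    (heq : ∀ z ∉ closure (Set.range γ), q.eval z * ω' z = -(p.eval z * ω z) + r.eval z)
    (hf : IsMultiaffine (configurations γ (n + 1)) ω Finset.univ f)
    (hne : (configurations γ (n + 1)).Nonempty) (k : ℕ) :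
    InRationalSpan (fun x => MvPolynomial.eval x)
      (fun (T : Finset (Fin (n + 1))) x => ∏ i ∈ T, ω (x i)) (configurations γ (n + 1))
      fun x => iteratedDeriv k (fun s => f (firstLine x s)) (x 0) := by
  refine (hf.inRationalSpan hne).iteratedDeriv (δ := MvPolynomial.pderiv 0)
    (e := Polynomial.aeval (MvPolynomial.X 0) q)
    (a := fun T T' => if 0 ∈ T then
      (if T' = T then -Polynomial.aeval (MvPolynomial.X 0) p else 0) +
        (if T' = T.erase 0 then Polynomial.aeval (MvPolynomial.X 0) r else 0) else 0)
    (fun x hx => eventually_firstLine_mem_configurations hx)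
    (fun r x _ => hasDerivAt_eval_firstLine r x)
    (fun T x hx => hasDerivAt_prod_firstLine hω hx T) ?_ (fun T x hx => ?_)
    (fun x hx => hf.analyticAt_firstLine hω hx) k
  · intro h
    refine hq (Polynomial.funext fun z => ?_)
    rw [← MvPolynomial.eval_aeval_X (fun _ : Fin (n + 1) => z) 0, h, map_zero, eval_zero]
  · by_cases hT : 0 ∈ T
    · simp only [hT, if_true, map_add, add_mul, Finset.sum_add_distrib,
        apply_ite (MvPolynomial.eval x), map_neg, map_zero, ite_mul, zero_mul, Finset.sum_ite_eq', Finset.mem_univ,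
        MvPolynomial.eval_aeval_X]
      rw [← Finset.mul_prod_erase T _ hT]
      linear_combination (∏ i ∈ T.erase 0, ω (x i)) * heq _ (hx.2 0)
    · simp [hT]

theorem IsMultiaffine.inRationalSpan_fiber_iteratedDeriv (hq : q ≠ 0)
    (hω : ∀ z ∉ closure (Set.range γ), HasDerivAt ω (ω' z) z)
    (heq : ∀ z ∉ closure (Set.range γ), q.eval z * ω' z = -(p.eval z * ω z) + r.eval z)
    (hf : IsMultiaffine (configurations γ (n + 1)) ω Finset.univ f) {y : Fin n → ℂ}
    (hne : (configurations γ (n + 1) ∩ {x | Fin.tail x = y}).Nonempty) (k : ℕ) :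
    InRationalSpan (fun x : Fin (n + 1) → ℂ => Polynomial.evalRingHom (x 0))
      (fun (c : Bool) x => if c then ω (x 0) else 1)
      (configurations γ (n + 1) ∩ {x | Fin.tail x = y})
      fun x => iteratedDeriv k (fun s => f (firstLine x s)) (x 0) := by
  refine (hf.inRationalSpan_fiber hne).iteratedDeriv (δ := Polynomial.derivative) (e := q)
    (a := fun c c' => if c then (if c' then -p else r) else 0)
    (b' := fun c x => if c then ω' (x 0) else 0)
    (fun x hx => ?_) (fun r x _ => by simpa using r.hasDerivAt (x 0)) (fun c x hx => ?_) hq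
    (fun c x hx => ?_) (fun x hx => hf.analyticAt_firstLine hω hx.1) k
  · filter_upwards [eventually_firstLine_mem_configurations hx.1] with s hs
    exact ⟨hs, (Fin.tail_cons _ _).trans hx.2⟩
  · cases c
    · simpa using hasDerivAt_const (x 0) (1 : ℂ)
    · simpa using hω _ (hx.1.2 0)
  · cases c
    · simp
    · simpa using heq _ (hx.1.2 0)

end Relations

theorem mainTheorem9 (dV : RatFunc ℂ) (γ v : ℝ → ℂ) (hγ : IsAdmissibleArc dV γ v)
    (hZ : ∀ N, partitionFunction γ v N ≠ 0)
    -- the number of points is `n = m + 1 ≥ 2`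
    (m : ℕ) (hm : 1 ≤ m) (W : ℕ → (Fin (m + 1) → ℂ) → ℂ)
    (hW : W = correlator γ v (m + 1) ∨ W = shiftedCorrelator γ v (m + 1))
    (N : ℕ) (hN : 1 ≤ N) :
    -- `W` is holomorphic in the first variable, so the derivatives below are genuine
    (∀ (y : Fin m → ℂ) (z : ℂ), Fin.cons z y ∈ configurations γ (m + 1) →
      AnalyticAt ℂ (fun s => W N (Fin.cons s y)) z) ∧
    -- recursion of order 4, coefficients polynomial in the first variable
    (∀ y : Fin m → ℂ, ∃ C : Fin 5 → ℂ[X], C ≠ 0 ∧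
      ∀ z : ℂ, Fin.cons z y ∈ configurations γ (m + 1) →
        ∑ k : Fin 5, (C k).eval z * W (N + k) (Fin.cons z y) = 0) ∧
    -- differential equation of order 4, coefficients polynomial in the first variable
    (∀ y : Fin m → ℂ, ∃ C : Fin 5 → ℂ[X], C ≠ 0 ∧
      ∀ z : ℂ, Fin.cons z y ∈ configurations γ (m + 1) →
        ∑ k : Fin 5, (C k).eval z * iteratedDeriv k (fun s => W N (Fin.cons s y)) z = 0) ∧
    -- recursion of order `4 ^ n`, coefficients polynomial in all variables
    (∃ C : Fin (4 ^ (m + 1) + 1) → MvPolynomial (Fin (m + 1)) ℂ, C ≠ 0 ∧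
      ∀ x ∈ configurations γ (m + 1),
        ∑ k : Fin (4 ^ (m + 1) + 1), (C k).eval x * W (N + k) x = 0) ∧
    -- differential equation of order `4 ^ n`, coefficients polynomial in all variables
    (∃ C : Fin (4 ^ (m + 1) + 1) → MvPolynomial (Fin (m + 1)) ℂ, C ≠ 0 ∧
      ∀ x ∈ configurations γ (m + 1),
        ∑ k : Fin (4 ^ (m + 1) + 1),
          (C k).eval x * iteratedDeriv k (fun s => W N (Fin.cons s (Fin.tail x))) (x 0) = 0) := by
  obtain ⟨r, ω', hode⟩ := hγ.exists_hasDerivAt_cauchyIntegral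
  have hω := fun z hz => (hode z hz).1
  have heq := fun z hz => (hode z hz).2
  have hq : dV.denom ≠ 0 := dV.denom_ne_zero
  have hWaff : ∀ N, IsMultiaffine (configurations γ (m + 1))
      (cauchyIntegral γ (arcWeight γ v)) Finset.univ (W N) := by
    rcases hW with rfl | rfl
    · exact hγ.isMultiaffine_correlator
    · exact hγ.isMultiaffine_shiftedCorrelator
  have hcard : Fintype.card (Finset (Fin (m + 1))) < 4 ^ (m + 1) + 1 := by
    rw [Fintype.card_finset, Fintype.card_fin, Nat.lt_succ_iff]
    exact Nat.pow_le_pow_left (by norm_num) _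
  -- without an admissible configuration every family of coefficients satisfies the relation
  have hfiber : ∀ (y : Fin m → ℂ) (f : Fin 5 → (Fin (m + 1) → ℂ) → ℂ),
      ((configurations γ (m + 1) ∩ {x | Fin.tail x = y}).Nonempty → ∀ k,
        InRationalSpan (fun x : Fin (m + 1) → ℂ => Polynomial.evalRingHom (x 0))
          (fun (c : Bool) x => if c then cauchyIntegral γ (arcWeight γ v) (x 0) else 1)
          (configurations γ (m + 1) ∩ {x | Fin.tail x = y}) (f k)) →
      ∃ C : Fin 5 → ℂ[X], C ≠ 0 ∧ ∀ z : ℂ, Fin.cons z y ∈ configurations γ (m + 1) →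
        ∑ k, (C k).eval z * f k (Fin.cons z y) = 0 := by
    intro y f hf
    by_cases hne : (configurations γ (m + 1) ∩ {x | Fin.tail x = y}).Nonempty
    · obtain ⟨C, hC, h⟩ := exists_linear_relation (by simp) (hf hne)
      exact ⟨C, hC, fun z hz => by simpa using h _ ⟨hz, Fin.tail_cons _ _⟩⟩
    · exact ⟨1, one_ne_zero, fun z hz => absurd ⟨_, hz, Fin.tail_cons _ _⟩ hne⟩
  have hall : ∀ f : Fin (4 ^ (m + 1) + 1) → (Fin (m + 1) → ℂ) → ℂ,
      ((configurations γ (m + 1)).Nonempty → ∀ k, InRationalSpan (fun x => MvPolynomial.eval x)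
        (fun (T : Finset (Fin (m + 1))) x => ∏ i ∈ T, cauchyIntegral γ (arcWeight γ v) (x i))
        (configurations γ (m + 1)) (f k)) →
      ∃ C : Fin (4 ^ (m + 1) + 1) → MvPolynomial (Fin (m + 1)) ℂ, C ≠ 0 ∧
        ∀ x ∈ configurations γ (m + 1), ∑ k, (C k).eval x * f k x = 0 := by
    intro f hf
    by_cases hne : (configurations γ (m + 1)).Nonempty
    · exact exists_linear_relation hcard (hf hne)
    · exact ⟨1, one_ne_zero, fun x hx => absurd ⟨x, hx⟩ hne⟩
  refine ⟨fun y z hz => ?_, fun y => ?_, fun y => ?_, ?_, ?_⟩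
  · simpa [firstLine] using (hWaff N).analyticAt_firstLine hω hz
  · exact hfiber y (fun k => W (N + k)) fun hne k => (hWaff _).inRationalSpan_fiber hne
  · simpa [firstLine] using hfiber y
      (fun k x => iteratedDeriv k (fun s => W N (firstLine x s)) (x 0)) fun hne k =>
        (hWaff N).inRationalSpan_fiber_iteratedDeriv hq hω heq hne k
  · exact hall (fun k => W (N + k)) fun hne k => (hWaff _).inRationalSpan hne
  · exact hall (fun k x => iteratedDeriv k (fun s => W N (firstLine x s)) (x 0)) fun hne k =>
      (hWaff N).inRationalSpan_iteratedDeriv hq hω heq hne k
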